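/- Let $k$ be a field, let $m \ge 1$, and let $r_1,\dots,r_m$ be integers with $r_i>1$ for all $i$. Let $f\in k[Z,T]$ with $f\neq 0$, let $g\in k[X_1,\dots,X_m,Z,T]$, and put $$F = f(Z,T) + (X_1\cdots X_m)\,g(X_1,\dots,X_m,Z,T),\qquad A=\frac{k[X_1,\dots,X_m,Y,Z,T]}{\left(X_1^{r_1}\cdots X_m^{r_m}\,Y-F(X_1,\dots,X_m,Z,T)\right)}.$$ Let $x_1,\dots,x_m$ denote the images of $X_1,\dots,X_m$ in $A$ and let $E=k[x_1,\dots,x_m]\subseteq A$. For a commutative ring $R$, an $R$-algebra $B$ and an integer $n\ge 0$, write $B=R^{[n]}$ if $B$ is isomorphic as an $R$-algebra to a polynomial ring in $n$ variables over $R$. A finitely generated flat $R$-algebra $B$ is called an $\mathbb{A}^n$-fibration over $R$ if $B\otimes_R\kappa(\mathfrak p)=\kappa(\mathfrak p)^{[n]}$ for every prime ideal $\mathfrak p$ of $R$, where $\kappa(\mathfrak p)=R_{\mathfrak p}/\mathfrak pR_{\mathfrak p}$. Then the following statements are equivalent: (i) $A$ is an $\mathbb{A}^2$-fibration over $E$.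 (ii) $A/(x_1,\dots,x_m)A=k^{[2]}$. (iii) $f$ is a line in $k[Z,T]$, i.e., $k[Z,T]/(f)=k^{[1]}$. -/

import Mathlib

open scoped TensorProduct

/-- `B = R^{[n]}`: the `R`-algebra `B` is a polynomial ring in `n` variables over `R`. -/
def IsPolynomialRing (n : ℕ) (R B : Type*) [CommRing R] [CommRing B] [Algebra R B] : Prop :=
  Nonempty (B ≃ₐ[R] MvPolynomial (Fin n) R)

/-- An `𝔸ⁿ`-fibration over `R`: a finitely generated flat `R`-algebra `B` with
`B ⊗_R κ(p) = κ(p)^{[n]}` for every prime ideal `p` of `R`. -/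
structure IsAffineFibration (n : ℕ) (R B : Type*) [CommRing R] [CommRing B] [Algebra R B] :
    Prop where
  finiteType : Algebra.FiniteType R B
  flat : Module.Flat R B
  fibre : ∀ (p : Ideal R) [p.IsPrime],
    IsPolynomialRing n p.ResidueField (p.ResidueField ⊗[R] B)

/-- A polynomial `h` in the two variables `Z = X 0`, `T = X 1` is a line if
`k[Z, T] / (h) = k^{[1]}`. -/
def IsLine {k : Type*} [Field k] (h : MvPolynomial (Fin 2) k) : Prop :=
  IsPolynomialRing 1 k (MvPolynomial (Fin 2) k ⧸ Ideal.span {h})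

namespace LinearHyperplane

variable {k : Type*} [Field k] {m : ℕ}

/-- `k[Z, T] → k[X₁, …, X_m, Z, T]`. The variable `X_i` is `X (Sum.inl i)`, and `Z`, `T` are
`X (Sum.inr 0)`, `X (Sum.inr 1)`. -/
noncomputable def inclZT (m : ℕ) :
    MvPolynomial (Fin 2) k →ₐ[k] MvPolynomial (Fin m ⊕ Fin 2) k :=
  MvPolynomial.rename Sum.inr

/-- `k[X₁, …, X_m, Z, T] → k[X₁, …, X_m, Y, Z, T]`. In the target the variable `X_i` is
`X (Sum.inl i)`, and `Y`, `Z`, `T` are `X (Sum.inr 0)`, `X (Sum.inr 1)`, `X (Sum.inr 2)`. -/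
noncomputable def inclXZT (m : ℕ) :
    MvPolynomial (Fin m ⊕ Fin 2) k →ₐ[k] MvPolynomial (Fin m ⊕ Fin 3) k :=
  MvPolynomial.rename (Sum.map id Fin.succ)

/-- `X₁^{r₁} ⋯ X_m^{r_m} Y - F(X₁, …, X_m, Z, T)` in `k[X₁, …, X_m, Y, Z, T]`. -/
noncomputable def hyperplane (r : Fin m → ℕ) (F : MvPolynomial (Fin m ⊕ Fin 2) k) :
    MvPolynomial (Fin m ⊕ Fin 3) k :=
  (∏ i, MvPolynomial.X (Sum.inl i) ^ r i) * MvPolynomial.X (Sum.inr 0) - inclXZT m F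

/-- `A = k[X₁, …, X_m, Y, Z, T] / (X₁^{r₁} ⋯ X_m^{r_m} Y - F)`. -/
abbrev A (r : Fin m → ℕ) (F : MvPolynomial (Fin m ⊕ Fin 2) k) : Type _ :=
  MvPolynomial (Fin m ⊕ Fin 3) k ⧸ Ideal.span {hyperplane r F}

/-- `x_i`, the image of `X_i` in `A`. -/
noncomputable def x (r : Fin m → ℕ) (F : MvPolynomial (Fin m ⊕ Fin 2) k) (i : Fin m) : A r F :=
  Ideal.Quotient.mk _ (MvPolynomial.X (Sum.inl i))

/-- `E = k[x₁, …, x_m]`, as a `k`-subalgebra of `A`. -/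
noncomputable def E (r : Fin m → ℕ) (F : MvPolynomial (Fin m ⊕ Fin 2) k) :
    Subalgebra k (A r F) :=
  Algebra.adjoin k (Set.range (x r F))

end LinearHyperplane

/-! Put `a = ∏ x_i ^ r_i` and `b = ∏ x_i`, so that `a ∣ b ^ n` for some `n`. Then `A = E[Z, T][Y] /
(aY - F)` with `F = f + b g`. At a prime where `a` does not vanish, `Y = F / a` is redundant and the
fibre is `κ[Z, T]`. Where `a` vanishes so does `b`, and the fibre is `(κ[Z, T] / (f))[Y]`, a
polynomial ring when `f` is a line. Flatness holds because `aY - F` stays a nonzerodivisor modulo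
every ideal of `E` (`Module.Flat.linear_hypersurface`). This gives (iii) → (i). For (i) → (ii), `A /
(x_1, …, x_m)` is the fibre over the origin of `E`. It is also `(k[Z, T] / (f))[Y]`, so (ii) → (iii)
is cancellation of one variable for curves, `isPolynomialRing_one_of_polynomial`. -/

/-! ### Flatness of linear hypersurfaces -/

open Polynomial in
/-- A linear polynomial `aY - F` is a nonzerodivisor when `F = f + bg` with `f` a nonzerodivisor and
some power of `b` lies in `(a)`. -/
theorem Polynomial.C_mul_X_sub_C_mem_nonZeroDivisors {R : Type*} [CommRing R] {a b f g : R} {n : ℕ}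
    (hf : f ∈ nonZeroDivisors R) (hab : a ∣ b ^ n) :
    (C a * X - C (f + b * g) : R[X]) ∈ nonZeroDivisors R[X] := by
  -- McCoy's theorem: only constant annihilators `c` have to be excluded.
  rw [Polynomial.mem_nonZeroDivisors_iff]
  intro c hc
  have h1 : c * a = 0 := by simpa using congrArg (fun p => coeff p 1) hc
  have h0 : c * (f + b * g) = 0 := by
    have := congrArg (fun p => coeff p 0) hc
    simp at this
    linear_combination -this
  obtain ⟨d, hd⟩ := hab
  -- On multiples of `c`, multiplication by `f` agrees with multiplication by `-bg`. Its `n`-th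
  -- power is a multiple of `a`, which kills `c`.
  have key : ∀ j : ℕ, c * f ^ j = c * (-(b * g)) ^ j := by
    intro j
    induction j with
    | zero => simp
    | succ j ih =>
      rw [pow_succ, ← mul_assoc, ih, pow_succ]
      linear_combination (-(b * g)) ^ j * h0
  have hz : c * f ^ n = 0 := by
    rw [key, ← neg_mul, mul_pow, neg_pow, hd]
    linear_combination ((-1) ^ n * d * g ^ n) * h1
  exact (mem_nonZeroDivisors_iff.mp (pow_mem hf n)).2 c hz

/-- The lexicographic leading coefficient of `f` is a unit of `k`, hence remains a unit in any
nontrivial `D`. No injectivity of coefficients is needed, so the result applies to all quotients of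
the base. -/
theorem MvPolynomial.map_mem_nonZeroDivisors {k D σ : Type*} [Field k] [CommRing D]
    [Finite σ] (φ : k →+* D) {f : MvPolynomial σ k} (hf : f ≠ 0) :
    MvPolynomial.map φ f ∈ nonZeroDivisors (MvPolynomial σ D) := by
  classical
  cases subsingleton_or_nontrivial D
  · rw [mem_nonZeroDivisors_iff]
    exact ⟨fun _ _ => Subsingleton.elim _ _, fun _ _ => Subsingleton.elim _ _⟩
  obtain ⟨n, ⟨e⟩⟩ := Finite.exists_equiv_fin σ
  let _ : LinearOrder σ := LinearOrder.lift' e e.injective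
  have hu : IsUnit (φ (MonomialOrder.lex.leadingCoeff f)) :=
    (IsUnit.mk0 _ (MonomialOrder.leadingCoeff_ne_zero_iff.mpr hf)).map φ
  have hd : MonomialOrder.lex.degree (MvPolynomial.map φ f) = MonomialOrder.lex.degree f := by
    apply MonomialOrder.lex.toSyn.injective
    apply le_antisymm
    · rw [MonomialOrder.degree_le_iff]
      intro d hd
      refine MonomialOrder.le_degree ?_
      rw [MvPolynomial.mem_support_iff] at hd ⊢
      intro h0
      rw [MvPolynomial.coeff_map, h0, map_zero] at hd
      exact hd rfl
    · refine MonomialOrder.le_degree ?_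
      rw [MvPolynomial.mem_support_iff, MvPolynomial.coeff_map]
      exact hu.ne_zero
  apply MonomialOrder.mem_nonZeroDivisors_of_leadingCoeff_mem_nonZeroDivisors
    (m := MonomialOrder.lex)
  rw [MonomialOrder.leadingCoeff, hd, MvPolynomial.coeff_map]
  exact hu.mem_nonZeroDivisors

/-- A hypersurface `H` in a flat algebra is flat if `H` is a nonzerodivisor modulo every ideal of
the base. -/
theorem Module.Flat.quotient_span_singleton {R P : Type*} [CommRing R] [CommRing P] [Algebra R P]
    [Module.Flat R P] (H : P)
    (hH : ∀ (I : Ideal R) (q : P), H * q ∈ I.map (algebraMap R P) → q ∈ I.map (algebraMap R P)) :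
    Module.Flat R (P ⧸ Ideal.span {H}) := by
  rw [Module.Flat.iff_rTensor_injective']
  intro I
  rw [injective_iff_map_eq_zero]
  intro u hu
  set π : P →ₗ[R] P ⧸ Ideal.span {H} := (Ideal.Quotient.mkₐ R (Ideal.span {H})).toLinearMap
  have hπ : Function.Surjective π := Ideal.Quotient.mk_surjective
  obtain ⟨v, rfl⟩ := LinearMap.lTensor_surjective I hπ u
  have hcomm : ∀ v : I ⊗[R] P,
      TensorProduct.lid R _ (LinearMap.rTensor (P ⧸ Ideal.span {H}) (Submodule.subtype I)
        (LinearMap.lTensor I π v)) =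
      π (TensorProduct.lid R P (LinearMap.rTensor P (Submodule.subtype I) v)) := by
    intro v
    induction v with
    | zero => simp
    | add a b ha hb => simp only [map_add, ha, hb]
    | tmul i p => simp
  -- Together with `hmem`, this identifies the image of `I ⊗ P` in `P` with `IP`.
  have hrange : ∀ q ∈ I.map (algebraMap R P), ∃ w : I ⊗[R] P,
      TensorProduct.lid R P (LinearMap.rTensor P (Submodule.subtype I) w) = q := by
    intro q hq
    induction hq using Submodule.span_induction with
    | mem x hx =>
      obtain ⟨i, hi, rfl⟩ := hx
      exact ⟨⟨i, hi⟩ ⊗ₜ 1, by simp [Algebra.smul_def]⟩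
    | zero => exact ⟨0, by simp⟩
    | add x y _ _ hx hy =>
      obtain ⟨a, rfl⟩ := hx
      obtain ⟨b, rfl⟩ := hy
      exact ⟨a + b, by simp⟩
    | smul c x hx' hx =>
      clear hx'
      obtain ⟨a, rfl⟩ := hx
      refine ⟨LinearMap.lTensor I (LinearMap.mulLeft R c) a, ?_⟩
      induction a with
      | zero => simp
      | add a b ha hb => simp only [map_add, ha, hb, smul_add]
      | tmul i p => simp
  have hmem : ∀ w : I ⊗[R] P,
      TensorProduct.lid R P (LinearMap.rTensor P (Submodule.subtype I) w) ∈
        I.map (algebraMap R P) := by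
    intro w
    induction w with
    | zero => simp
    | add a b ha hb => simp only [map_add]; exact add_mem ha hb
    | tmul i p =>
      simp only [LinearMap.rTensor_tmul, Submodule.subtype_apply, TensorProduct.lid_tmul,
        Algebra.smul_def]
      exact Ideal.mul_mem_right _ _ (Ideal.mem_map_of_mem _ i.2)
  have h0 : π (TensorProduct.lid R P (LinearMap.rTensor P (Submodule.subtype I) v)) = 0 := by
    rw [← hcomm, hu, map_zero]
  obtain ⟨q, hq⟩ := Ideal.mem_span_singleton.mp (Ideal.Quotient.eq_zero_iff_mem.mp h0)
  obtain ⟨w, hw⟩ := hrange q (hH I q (hq ▸ hmem v))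
  -- Both sides have image `Hq` in `P`, and `I ⊗ P → P` is injective by flatness of `P`. A multiple
  -- of `H` dies in `I ⊗ P / (H)`.
  have hv : v = LinearMap.lTensor I (LinearMap.mulLeft R H) w := by
    apply Module.Flat.rTensor_preserves_injective_linearMap (M := P) (Submodule.subtype I)
      (Submodule.subtype_injective I)
    apply (TensorProduct.lid R P).injective
    rw [hq, ← hw]
    clear hw
    induction w with
    | zero => simp
    | add a b ha hb => simp only [map_add, mul_add, ha, hb]
    | tmul i p => simp
  have hcomp : π ∘ₗ LinearMap.mulLeft R H = 0 := by
    ext p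
    exact Ideal.Quotient.eq_zero_iff_mem.mpr
      (Ideal.mul_mem_right _ _ (Ideal.mem_span_singleton_self H))
  rw [hv, ← LinearMap.lTensor_comp_apply, hcomp]
  simp

open Polynomial in
/-- Flatness of `R[Z, T][Y] / (aY - F)` over a `k`-algebra `R`. -/
theorem Module.Flat.linear_hypersurface {k R σ : Type*} [Field k] [CommRing R] [Algebra k R]
    [Finite σ] {f : MvPolynomial σ k} (hf : f ≠ 0) {a b : R} {n : ℕ} (hab : a ∣ b ^ n)
    (g : MvPolynomial σ R) :
    Module.Flat R ((MvPolynomial σ R)[X] ⧸ Ideal.span {(C (MvPolynomial.C a) * X -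
      C (MvPolynomial.map (algebraMap k R) f + MvPolynomial.C b * g) :
        (MvPolynomial σ R)[X])}) := by
  have : Module.Flat R (MvPolynomial σ R)[X] :=
    Module.Flat.trans R (MvPolynomial σ R) (MvPolynomial σ R)[X]
  apply Module.Flat.quotient_span_singleton
  intro I
  let ψ : (MvPolynomial σ R)[X] →+* (MvPolynomial σ (R ⧸ I))[X] :=
    Polynomial.mapRingHom (MvPolynomial.map (Ideal.Quotient.mk I))
  -- The extension of `I` is the kernel of reducing coefficients modulo `I`; the reduced equation
  -- has the same shape over `R ⧸ I`.
  have hψ : ∀ q, q ∈ I.map (algebraMap R (MvPolynomial σ R)[X]) ↔ ψ q = 0 := by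
    intro q
    rw [show algebraMap R (MvPolynomial σ R)[X] = Polynomial.C.comp MvPolynomial.C from rfl,
      ← Ideal.map_map, Ideal.mem_map_C_iff, Polynomial.ext_iff]
    refine forall_congr' fun j => ?_
    rw [MvPolynomial.mem_map_C_iff, MvPolynomial.ext_iff]
    simp [ψ, MvPolynomial.coeff_map, Ideal.Quotient.eq_zero_iff_mem]
  intro q
  rw [hψ, hψ, map_mul]
  have := Polynomial.C_mul_X_sub_C_mem_nonZeroDivisors
    (MvPolynomial.map_mem_nonZeroDivisors (σ := σ) ((Ideal.Quotient.mk I).comp (algebraMap k R)) hf)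
    (g := MvPolynomial.map (Ideal.Quotient.mk I) g) (a := MvPolynomial.C (Ideal.Quotient.mk I a))
    (b := MvPolynomial.C (Ideal.Quotient.mk I b)) (n := n)
    (by rw [← map_pow, ← map_pow]; exact map_dvd _ (map_dvd _ hab))
  intro h
  refine (mem_nonZeroDivisors_iff.mp this).1 _ ?_
  rw [← h]
  simp [ψ, MvPolynomial.map_map]

/-! ### Cancellation for curves -/

open Polynomial in
/-- Cancellation for curves: if `C[Y]` is a polynomial ring in two variables over a field `k`, then
`C` is a polynomial ring in one variable. -/
theorem isPolynomialRing_one_of_polynomial {k R : Type*} [Field k] [CommRing R] [Algebra k R]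
    (h : IsPolynomialRing 2 k R[X]) : IsPolynomialRing 1 k R := by
  obtain ⟨e⟩ := h
  have : IsDomain R[X] := e.toMulEquiv.isDomain _
  have : IsDomain R := (Polynomial.C_injective (R := R)).isDomain Polynomial.C
  have : UniqueFactorizationMonoid R[X] :=
    e.symm.toMulEquiv.uniqueFactorizationMonoid inferInstance
  have : IsNoetherianRing R[X] := isNoetherianRing_of_ringEquiv _ e.symm.toRingEquiv
  have : IsNoetherianRing R :=
    isNoetherianRing_of_surjective R[X] R (Polynomial.constantCoeff)
      (fun r => ⟨Polynomial.C r, by simp⟩)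
  have hdim : ringKrullDim R + 1 = 2 := by
    rw [← Polynomial.ringKrullDim_of_isNoetherianRing, ringKrullDim_eq_of_ringEquiv e.toRingEquiv,
      MvPolynomial.ringKrullDim_of_isNoetherianRing, ringKrullDim_eq_zero_of_field]
    simp
  have hdim1 : ringKrullDim R = 1 := by
    rw [show (2 : WithBot ℕ∞) = 1 + 1 by norm_num] at hdim
    exact ENat.WithBot.add_one_cancel.mp hdim
  have : Ring.KrullDimLE 1 R := by
    rw [Ring.krullDimLE_iff, hdim1]; rfl
  -- The embedding `j` gives `R` an additive degree, and evaluation at the origin gives a rational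
  -- point `ε`. The goal is `R = k[s]` for a generator `s` of `ker ε`.
  let j : R →ₐ[k] MvPolynomial (Fin 2) k := e.toAlgHom.comp (Algebra.algHom k R R[X])
  have hj : Function.Injective j := e.injective.comp Polynomial.C_injective
  let ε : R →ₐ[k] k := (MvPolynomial.aeval 0).comp j
  have hε : Function.Surjective ε := fun c => ⟨algebraMap k R c, by simp⟩
  have hprime : (RingHom.ker ε).IsPrime := RingHom.ker_isPrime _
  have hne : RingHom.ker ε ≠ ⊥ := by
    intro hb
    have hbij : Function.Bijective ε := ⟨(RingHom.injective_iff_ker_eq_bot _).mpr hb, hε⟩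
    have := ringKrullDim_eq_of_ringEquiv (RingEquiv.ofBijective ε hbij)
    rw [hdim1, ringKrullDim_eq_zero_of_field] at this
    exact absurd this (by decide)
  -- Factor a nonzero constant `c ∈ ker ε` in the factorial ring `R[X]`. Some prime factor lies in
  -- the extended prime ideal, and as a divisor of a constant it has degree zero, so it comes from
  -- `R`.
  obtain ⟨s, hs, hsM⟩ : ∃ s : R, Prime s ∧ s ∈ RingHom.ker ε := by
    obtain ⟨c, hc, hc0⟩ := Submodule.exists_mem_ne_zero_of_ne_bot hne
    obtain ⟨l, hl, u, hu⟩ := UniqueFactorizationMonoid.exists_prime_factors (C c : R[X])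
      (by simpa using hc0)
    have hM : ((RingHom.ker ε).map (C : R →+* R[X])).IsPrime := Ideal.isPrime_map_C_of_isPrime
    have hmem : l.prod ∈ (RingHom.ker ε).map (C : R →+* R[X]) := by
      rw [← Ideal.unit_mul_mem_iff_mem _ u.isUnit, mul_comm, hu]
      exact Ideal.mem_map_of_mem _ hc
    obtain ⟨q, hq, hqM⟩ := (hM.multiset_prod_mem_iff_exists_mem l).mp hmem
    have hdvd : q ∣ C c := (Multiset.dvd_prod hq).trans ⟨u, hu.symm⟩
    have hdeg : q.natDegree = 0 := by
      have := natDegree_le_of_dvd hdvd (by simpa using hc0)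
      simpa using this
    obtain ⟨p, rfl⟩ := natDegree_eq_zero.mp hdeg
    refine ⟨p, Polynomial.prime_C_iff.mp (hl _ hq), ?_⟩
    simpa using Ideal.mem_map_C_iff.mp hqM 0
  -- In a one-dimensional domain the nonzero prime ideal `(s)` is already maximal.
  have hspan : RingHom.ker ε = Ideal.span {s} := by
    refine ((Prime.isMaximal_span_singleton hs).eq_of_le hprime.ne_top ?_).symm
    rwa [Ideal.span_singleton_le_iff_mem]
  have hs0 : s ≠ 0 := hs.ne_zero
  have hjs : 1 ≤ (j s).totalDegree := by
    by_contra hlt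
    have h0 : (j s).totalDegree = 0 := by omega
    rw [MvPolynomial.totalDegree_eq_zero_iff_eq_C] at h0
    have h1 : ε s = 0 := hsM
    have h2 : ε s = MvPolynomial.coeff 0 (j s) := by
      change MvPolynomial.aeval 0 (j s) = _
      rw [h0]; simp
    rw [← h2, h1, map_zero] at h0
    exact hs0 (hj (by rw [h0, map_zero]))
  -- Descent: `c - ε c = s d`, and `d` has smaller degree than `c` because `j s` has positive
  -- degree.
  have hsurj : ∀ (n : ℕ) (c : R), (j c).totalDegree < n → ∃ p : k[X], aeval s p = c := by
    intro n
    induction n with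
    | zero => intro c hc; omega
    | succ n ih =>
      intro c hc
      have hmem : c - algebraMap k R (ε c) ∈ Ideal.span {s} := by
        rw [← hspan, RingHom.mem_ker]; simp
      obtain ⟨d, hd⟩ := Ideal.mem_span_singleton.mp hmem
      by_cases hd0 : d = 0
      · refine ⟨C (ε c), ?_⟩
        rw [hd0, mul_zero, sub_eq_zero] at hd
        simpa using hd.symm
      obtain ⟨p, hp⟩ := ih d (by
        have h1 : (j s * j d).totalDegree = (j s).totalDegree + (j d).totalDegree :=
          MvPolynomial.totalDegree_mul_of_isDomain (by simpa using hj.ne hs0)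
            (by simpa using hj.ne hd0)
        have h2 : (j s * j d).totalDegree ≤ (j c).totalDegree := by
          rw [← map_mul, ← hd, map_sub, AlgHom.commutes]
          exact MvPolynomial.totalDegree_sub_C_le _ _
        omega)
      refine ⟨C (ε c) + X * p, ?_⟩
      rw [map_add, map_mul, aeval_X, aeval_C, hp, ← hd]
      ring
  -- Applying `ε` to `p(s) = 0` kills the constant term; then cancel `s` and repeat.
  have hinj : ∀ (n : ℕ) (p : k[X]), p.natDegree < n → aeval s p = 0 → p = 0 := by
    intro n
    induction n with
    | zero => intro p hp; omega
    | succ n ih =>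
      intro p hp h0
      have hX := Polynomial.divX_mul_X_add p
      have hc : p.coeff 0 = 0 := by
        have h1 : ε (aeval s p) = 0 := by rw [h0, map_zero]
        rw [← hX] at h1
        have h2 : ε s = 0 := hsM
        simpa [h2] using h1
      rw [hc, map_zero, add_zero] at hX
      have h1 : aeval s p.divX = 0 := by
        rw [← hX, map_mul, aeval_X] at h0
        exact (mul_eq_zero.mp h0).resolve_right hs0
      by_cases hp0 : p.natDegree = 0
      · rw [Polynomial.eq_C_of_natDegree_eq_zero hp0, hc, map_zero]
      rw [← hX, ih p.divX (by rw [natDegree_divX_eq_natDegree_tsub_one]; omega) h1, zero_mul]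
  let e1 : k[X] ≃ₐ[k] R := AlgEquiv.ofBijective (aeval s)
    ⟨(injective_iff_map_eq_zero _).mpr fun p hp => hinj _ p (Nat.lt_succ_self _) hp,
      fun c => hsurj _ c (Nat.lt_succ_self _)⟩
  exact ⟨e1.symm.trans (MvPolynomial.uniqueAlgEquiv k (Fin 1)).symm⟩

/-! ### The algebra `A` and its base `E` -/

namespace LinearHyperplane

variable {k : Type*} [Field k] {m : ℕ}

section Lift

variable (r : Fin m → ℕ) (F : MvPolynomial (Fin m ⊕ Fin 2) k)

/-- The image of `Y` in `A`. -/
noncomputable def y : A r F := Ideal.Quotient.mk _ (MvPolynomial.X (Sum.inr 0))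

/-- The images of `Z` and `T` in `A`. -/
noncomputable def zt (i : Fin 2) : A r F := Ideal.Quotient.mk _ (MvPolynomial.X (Sum.inr i.succ))

variable {r F} {B : Type*} [CommRing B] [Algebra k B]

theorem aeval_hyperplane (xs : Fin m → B) (y' : B) (zt' : Fin 2 → B) :
    MvPolynomial.aeval (Sum.elim xs (Fin.cons y' zt')) (hyperplane r F) =
      (∏ i, xs i ^ r i) * y' - MvPolynomial.aeval (Sum.elim xs zt') F := by
  have : (Sum.elim xs (Fin.cons y' zt' : Fin 3 → B)) ∘ Sum.map id Fin.succ = Sum.elim xs zt' := by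
    funext i
    cases i <;> simp
  simp [hyperplane, inclXZT, MvPolynomial.aeval_rename, this]

/-- The universal property of `A`. -/
noncomputable def lift (xs : Fin m → B) (y' : B) (zt' : Fin 2 → B)
    (h : (∏ i, xs i ^ r i) * y' = MvPolynomial.aeval (Sum.elim xs zt') F) : A r F →ₐ[k] B :=
  Ideal.Quotient.liftₐ _ (MvPolynomial.aeval (Sum.elim xs (Fin.cons y' zt'))) (by
    intro a ha
    obtain ⟨c, rfl⟩ := Ideal.mem_span_singleton.mp ha
    rw [map_mul, aeval_hyperplane, h, sub_self, zero_mul])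

section

variable (xs : Fin m → B) (y' : B) (zt' : Fin 2 → B)
    (h : (∏ i, xs i ^ r i) * y' = MvPolynomial.aeval (Sum.elim xs zt') F)

@[simp] theorem lift_x (i : Fin m) : lift xs y' zt' h (x r F i) = xs i :=
  MvPolynomial.aeval_X _ _

@[simp] theorem lift_y : lift xs y' zt' h (y r F) = y' :=
  MvPolynomial.aeval_X _ _

@[simp] theorem lift_zt (i : Fin 2) : lift xs y' zt' h (zt r F i) = zt' i :=
  MvPolynomial.aeval_X _ _

end

theorem algHom_ext {φ ψ : A r F →ₐ[k] B} (hx : ∀ i, φ (x r F i) = ψ (x r F i))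
    (hy : φ (y r F) = ψ (y r F)) (hzt : ∀ i, φ (zt r F i) = ψ (zt r F i)) : φ = ψ := by
  apply Ideal.Quotient.algHom_ext
  apply MvPolynomial.algHom_ext
  rintro (i | i)
  · exact hx i
  · induction i using Fin.cases with
    | zero => exact hy
    | succ i => exact hzt i

variable (r F) in
theorem relation : (∏ i, x r F i ^ r i) * y r F =
    MvPolynomial.aeval (Sum.elim (x r F) (zt r F)) F := by
  rw [← sub_eq_zero, ← aeval_hyperplane]
  have : MvPolynomial.aeval (Sum.elim (x r F) (Fin.cons (y r F) (zt r F))) =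
      Ideal.Quotient.mkₐ k (Ideal.span {hyperplane r F}) := by
    apply MvPolynomial.algHom_ext
    rintro (i | i)
    · simp [x]
    · induction i using Fin.cases with
      | zero => simp [y]
      | succ i => simp [zt]
  rw [this]
  exact Ideal.Quotient.eq_zero_iff_mem.mpr (Ideal.mem_span_singleton_self _)

theorem aeval_eq {f : MvPolynomial (Fin 2) k} {g : MvPolynomial (Fin m ⊕ Fin 2) k}
    (hF : F = inclZT m f + (∏ i, MvPolynomial.X (Sum.inl i)) * g) (xs : Fin m → B)
    (zt' : Fin 2 → B) : MvPolynomial.aeval (Sum.elim xs zt') F =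
      MvPolynomial.aeval zt' f + (∏ i, xs i) * MvPolynomial.aeval (Sum.elim xs zt') g := by
  simp [hF, inclZT, MvPolynomial.aeval_rename, Function.comp_def]

/-- Supplies the hypothesis `a ∣ b ^ n` of the flatness and fibration results. -/
theorem prod_dvd_pow {r : Fin m → ℕ} {B : Type*} [CommRing B] (xs : Fin m → B) :
    (∏ i, xs i ^ r i) ∣ (∏ i, xs i) ^ (∑ i, r i) := by
  rw [← Finset.prod_pow]
  exact Finset.prod_dvd_prod_of_dvd _ _ fun i _ =>
    pow_dvd_pow _ (Finset.single_le_sum (fun _ _ => Nat.zero_le _) (Finset.mem_univ i))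

end Lift

section Base

variable (r : Fin m → ℕ) (F : MvPolynomial (Fin m ⊕ Fin 2) k)

/-- `x_i` as an element of `E`. -/
noncomputable def xE (i : Fin m) : E r F := ⟨x r F i, Algebra.subset_adjoin ⟨i, rfl⟩⟩

@[simp] theorem algebraMap_xE (i : Fin m) : algebraMap (E r F) (A r F) (xE r F i) = x r F i := rfl

@[simp] theorem coe_xE (i : Fin m) : (xE r F i : A r F) = x r F i := rfl

variable {r F} {B : Type*} [CommRing B] [Algebra k B]

theorem algHom_ext_E {φ ψ : E r F →ₐ[k] B} (h : ∀ i, φ (xE r F i) = ψ (xE r F i)) : φ = ψ := by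
  apply AlgHom.adjoin_ext
  rintro _ ⟨i, rfl⟩
  exact h i

variable [Algebra (E r F) B] [IsScalarTower k (E r F) B]

/-- A `k`-algebra homomorphism from `A` that is compatible with the `x_i` is `E`-linear. -/
noncomputable def toAlgHomE (φ : A r F →ₐ[k] B)
    (h : ∀ i, φ (x r F i) = algebraMap (E r F) B (xE r F i)) : A r F →ₐ[E r F] B where
  __ := φ
  commutes' e := by
    have : φ.comp (IsScalarTower.toAlgHom k (E r F) (A r F)) = IsScalarTower.toAlgHom k (E r F) B :=
      algHom_ext_E fun i => by simpa using h i
    exact DFunLike.congr_fun this e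

theorem algHomE_ext {φ ψ : A r F →ₐ[E r F] B}
    (hy : φ (y r F) = ψ (y r F)) (hzt : ∀ i, φ (zt r F i) = ψ (zt r F i)) : φ = ψ := by
  have : φ.restrictScalars k = ψ.restrictScalars k := by
    refine algHom_ext (fun i => ?_) hy hzt
    rw [← algebraMap_xE]
    simp only [AlgHom.restrictScalars_apply, AlgHom.commutes]
  exact AlgHom.ext fun a => DFunLike.congr_fun this a

-- Algebraic independence of the `x_i` is seen in the fraction field of `k[X, Z, T]`, to which `A`
-- maps by `Y ↦ F / ∏ X_i ^ r_i`.
variable (r F) in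
theorem bijective_aeval_xE : Function.Bijective
    (MvPolynomial.aeval (xE r F) : MvPolynomial (Fin m) k →ₐ[k] E r F) := by
  constructor
  · let P := MvPolynomial (Fin m ⊕ Fin 2) k
    let ι := algebraMap P (FractionRing P)
    have hprod : (∏ i, ι (MvPolynomial.X (Sum.inl i)) ^ r i) ≠ 0 := by
      refine Finset.prod_ne_zero_iff.mpr fun i _ => pow_ne_zero _ ?_
      rw [ne_eq, FaithfulSMul.algebraMap_eq_zero_iff]
      exact MvPolynomial.X_ne_zero _
    let φ : A r F →ₐ[k] FractionRing P :=
      lift (fun i => ι (MvPolynomial.X (Sum.inl i)))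
        (MvPolynomial.aeval (Sum.elim (fun i => ι (MvPolynomial.X (Sum.inl i)))
          (fun i => ι (MvPolynomial.X (Sum.inr i)))) F / ∏ i, ι (MvPolynomial.X (Sum.inl i)) ^ r i)
        (fun i => ι (MvPolynomial.X (Sum.inr i))) (mul_div_cancel₀ _ hprod)
    have h : (φ.comp (E r F).val).comp (MvPolynomial.aeval (xE r F)) =
        (IsScalarTower.toAlgHom k P (FractionRing P)).comp (MvPolynomial.rename Sum.inl) := by
      apply MvPolynomial.algHom_ext
      intro i
      simp only [AlgHom.comp_apply, MvPolynomial.aeval_X, Subalgebra.val_apply, coe_xE, φ, lift_x]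
      exact congrArg ι (MvPolynomial.rename_X _ _).symm
    have hinj : Function.Injective
        ((φ.comp (E r F).val).comp (MvPolynomial.aeval (xE r F))) := by
      rw [h]
      exact (IsFractionRing.injective P (FractionRing P)).comp
        (MvPolynomial.rename_injective _ Sum.inl_injective)
    exact Function.Injective.of_comp (f := φ.comp (E r F).val) hinj
  · rw [← AlgHom.range_eq_top, eq_top_iff]
    rintro ⟨a, ha⟩ -
    induction ha using Algebra.adjoin_induction with
    | mem a h =>
      obtain ⟨i, rfl⟩ := h
      exact ⟨MvPolynomial.X i, by simp [xE]⟩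
    | algebraMap c => exact (MvPolynomial.aeval (xE r F)).range.algebraMap_mem c
    | add a b _ _ ha hb => exact add_mem ha hb
    | mul a b _ _ ha hb => exact mul_mem ha hb

variable (r F) in
/-- The augmentation `E → k`, `x_i ↦ 0`. -/
noncomputable def augmentation : E r F →ₐ[k] k :=
  (MvPolynomial.aeval 0).comp (AlgEquiv.ofBijective _ (bijective_aeval_xE r F)).symm.toAlgHom

@[simp] theorem augmentation_xE (i : Fin m) : augmentation r F (xE r F i) = 0 := by
  have : (AlgEquiv.ofBijective _ (bijective_aeval_xE r F)).symm (xE r F i) = MvPolynomial.X i := by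
    rw [AlgEquiv.symm_apply_eq]
    simp
  simp [augmentation, this]

end Base

end LinearHyperplane

/-! ### Fibres over rational points -/

/-- Over a rational point of the base, the fibre of an affine fibration is a polynomial ring. -/
theorem IsAffineFibration.isPolynomialRing_quotient {n : ℕ} {k R B : Type*} [Field k] [CommRing R]
    [CommRing B] [Algebra k R] [Algebra R B] [Algebra k B] [IsScalarTower k R B]
    (h : IsAffineFibration n R B) (ε : R →ₐ[k] k) :
    IsPolynomialRing n k (B ⧸ (RingHom.ker ε).map (algebraMap R B)) := by
  let p := RingHom.ker ε
  have hsurj : Function.Surjective ε := fun c => ⟨algebraMap k _ c, by simp⟩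
  have hmax : p.IsMaximal := RingHom.ker_isMaximal_of_surjective _ hsurj
  obtain ⟨e⟩ := h.fibre p
  let κ := p.ResidueField
  let Q := B ⧸ p.map (algebraMap R B)
  have hε : ∀ a : R, a - algebraMap k R (ε a) ∈ p := fun a => by simp [p, RingHom.mem_ker]
  have hκ : ∀ a : R, algebraMap R κ a = algebraMap k κ (ε a) := by
    intro a
    rw [IsScalarTower.algebraMap_apply k R κ, ← sub_eq_zero, ← map_sub,
      Ideal.algebraMap_residueField_eq_zero]
    exact hε a
  have hQ : ∀ a ∈ p, algebraMap R Q a = 0 := fun a ha =>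
    Ideal.Quotient.eq_zero_iff_mem.mpr (Ideal.mem_map_of_mem _ ha)
  let eκ : k ≃ₐ[k] κ := AlgEquiv.ofBijective (Algebra.ofId k κ) ⟨RingHom.injective _, fun c => by
    obtain ⟨a, rfl⟩ := p.algebraMap_residueField_surjective c
    exact ⟨ε a, (hκ a).symm⟩⟩
  let ι : B →ₐ[R] κ ⊗[R] B := Algebra.TensorProduct.includeRight
  let Φ : Q →ₐ[R] κ ⊗[R] B := Ideal.Quotient.liftₐ _ ι (by
    intro b hb
    refine (Ideal.map_le_iff_le_comap (K := RingHom.ker ι)).mpr ?_ hb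
    intro a ha
    change ι (algebraMap R B a) = 0
    rw [ι.commutes, IsScalarTower.algebraMap_apply R κ,
      Ideal.algebraMap_residueField_eq_zero.mpr ha, map_zero])
  -- An element `a` outside `p` acts on `Q` as the nonzero constant `ε a`, hence invertibly.
  let ρ : κ →ₐ[R] Q := Ideal.ResidueField.liftₐ p (Algebra.ofId R Q) hQ
    (fun a ha => by
      have ha' : ε a ≠ 0 := ha
      have h1 := hQ _ (hε a)
      rw [map_sub, sub_eq_zero] at h1
      change IsUnit (algebraMap R Q a)
      rw [h1]
      exact ((IsUnit.mk0 _ ha').map _).map _)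
  let Ψ : κ ⊗[R] B →ₐ[R] Q :=
    Algebra.TensorProduct.lift ρ (Ideal.Quotient.mkₐ R _) (fun _ _ => Commute.all _ _)
  have h1 : Φ.comp Ψ = AlgHom.id _ _ := by
    apply Algebra.TensorProduct.ext
    · ext
    · ext b
      change Φ (Ψ (1 ⊗ₜ b)) = 1 ⊗ₜ b
      rw [Algebra.TensorProduct.lift_tmul, map_one, one_mul]
      rfl
  have h2 : Ψ.comp Φ = AlgHom.id _ _ := by
    apply Ideal.Quotient.algHom_ext
    ext b
    change Ψ (1 ⊗ₜ b) = _
    rw [Algebra.TensorProduct.lift_tmul, map_one, one_mul]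
    rfl
  exact ⟨((AlgEquiv.ofAlgHom Φ Ψ h1 h2).restrictScalars k).trans
    ((e.restrictScalars k).trans (MvPolynomial.mapAlgEquiv _ eκ.symm))⟩

/-! ### The model `S[Z, T][Y] / (aY - F)` and its fibres -/

/-- The algebra `S[Z, T][Y] / (aY - F)`. -/
def LinearHypersurface (S : Type*) [CommRing S] (a : S) (F : MvPolynomial (Fin 2) S) : Type _ :=
  Polynomial (MvPolynomial (Fin 2) S) ⧸ Ideal.span
    {(Polynomial.C (MvPolynomial.C a) * Polynomial.X - Polynomial.C F :
      Polynomial (MvPolynomial (Fin 2) S))}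

namespace LinearHypersurface

variable {S : Type*} [CommRing S] (a : S) (F : MvPolynomial (Fin 2) S)

noncomputable instance : CommRing (LinearHypersurface S a F) :=
  inferInstanceAs (CommRing (Polynomial (MvPolynomial (Fin 2) S) ⧸ Ideal.span
    {(Polynomial.C (MvPolynomial.C a) * Polynomial.X - Polynomial.C F :
      Polynomial (MvPolynomial (Fin 2) S))}))

noncomputable instance {k : Type*} [CommRing k] [Algebra k S] :
    Algebra k (LinearHypersurface S a F) :=
  inferInstanceAs (Algebra k (Polynomial (MvPolynomial (Fin 2) S) ⧸ Ideal.span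
    {(Polynomial.C (MvPolynomial.C a) * Polynomial.X - Polynomial.C F :
      Polynomial (MvPolynomial (Fin 2) S))}))

instance {k : Type*} [CommRing k] [Algebra k S] :
    IsScalarTower k S (LinearHypersurface S a F) :=
  inferInstanceAs (IsScalarTower k S (Polynomial (MvPolynomial (Fin 2) S) ⧸ Ideal.span
    {(Polynomial.C (MvPolynomial.C a) * Polynomial.X - Polynomial.C F :
      Polynomial (MvPolynomial (Fin 2) S))}))

/-- The image of `Y`. -/
noncomputable def y : LinearHypersurface S a F := Ideal.Quotient.mk _ Polynomial.X

/-- The images of `Z` and `T`. -/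
noncomputable def zt (i : Fin 2) : LinearHypersurface S a F :=
  Ideal.Quotient.mk _ (Polynomial.C (MvPolynomial.X i))

theorem relation : algebraMap S _ a * y a F = MvPolynomial.aeval (zt a F) F := by
  let q := Ideal.Quotient.mkₐ S (Ideal.span
    {(Polynomial.C (MvPolynomial.C a) * Polynomial.X - Polynomial.C F :
      Polynomial (MvPolynomial (Fin 2) S))})
  have h1 : (MvPolynomial.aeval (zt a F) : _ →ₐ[S] LinearHypersurface S a F) =
      q.comp (Algebra.algHom S (MvPolynomial (Fin 2) S) _) := by
    apply MvPolynomial.algHom_ext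
    intro i
    rw [MvPolynomial.aeval_X]
    rfl
  have h2 : q (Polynomial.C (MvPolynomial.C a) * Polynomial.X - Polynomial.C F) = 0 :=
    Ideal.Quotient.eq_zero_iff_mem.mpr (Ideal.mem_span_singleton_self _)
  rw [map_sub, map_mul, sub_eq_zero] at h2
  rw [h1]
  exact h2

section Lift

variable {a F} {B : Type*} [CommRing B] [Algebra S B]

/-- The universal property of `S[Z, T][Y] / (aY - F)`. -/
noncomputable def lift (y' : B) (z' : Fin 2 → B)
    (h : algebraMap S B a * y' = MvPolynomial.aeval z' F) : LinearHypersurface S a F →ₐ[S] B :=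
  Ideal.Quotient.liftₐ _
    (Polynomial.eval₂AlgHom (MvPolynomial.aeval z') y' (fun _ => Commute.all _ _)) (by
      intro c hc
      obtain ⟨d, rfl⟩ := Ideal.mem_span_singleton.mp hc
      rw [map_mul]
      simp [h])

@[simp] theorem lift_y (y' : B) (z' : Fin 2 → B)
    (h : algebraMap S B a * y' = MvPolynomial.aeval z' F) : lift y' z' h (y a F) = y' :=
  Polynomial.eval₂_X _ _

@[simp] theorem lift_zt (y' : B) (z' : Fin 2 → B)
    (h : algebraMap S B a * y' = MvPolynomial.aeval z' F) (i : Fin 2) :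
    lift y' z' h (zt a F i) = z' i :=
  (Polynomial.eval₂_C _ _).trans (MvPolynomial.aeval_X _ _)

theorem algHom_ext {φ ψ : LinearHypersurface S a F →ₐ[S] B} (hy : φ (y a F) = ψ (y a F))
    (hz : ∀ i, φ (zt a F i) = ψ (zt a F i)) : φ = ψ := by
  apply Ideal.Quotient.algHom_ext
  apply Polynomial.algHom_ext'
  · apply MvPolynomial.algHom_ext
    exact hz
  · exact hy

end Lift

theorem flat {k : Type*} [Field k] [Algebra k S] {a b : S} {n : ℕ} (hab : a ∣ b ^ n)
    {f : MvPolynomial (Fin 2) k} (hf : f ≠ 0) (g : MvPolynomial (Fin 2) S) :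
    Module.Flat S (LinearHypersurface S a
      (MvPolynomial.map (algebraMap k S) f + MvPolynomial.C b * g)) :=
  Module.Flat.linear_hypersurface hf hab g

instance : Algebra.FiniteType S (LinearHypersurface S a F) :=
  inferInstanceAs (Algebra.FiniteType S (Polynomial (MvPolynomial (Fin 2) S) ⧸ Ideal.span
    {(Polynomial.C (MvPolynomial.C a) * Polynomial.X - Polynomial.C F :
      Polynomial (MvPolynomial (Fin 2) S))}))

/-- Base change. -/
theorem nonempty_baseChange (K : Type*) [CommRing K] [Algebra S K] :
    Nonempty (K ⊗[S] LinearHypersurface S a F ≃ₐ[K]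
      LinearHypersurface K (algebraMap S K a) (MvPolynomial.map (algebraMap S K) F)) := by
  let H := LinearHypersurface K (algebraMap S K a) (MvPolynomial.map (algebraMap S K) F)
  let φ : LinearHypersurface S a F →ₐ[S] H := lift (y _ _) (zt _ _) (by
    have h := relation (algebraMap S K a) (MvPolynomial.map (algebraMap S K) F)
    rw [MvPolynomial.aeval_map_algebraMap] at h
    rw [← h]
    exact congrArg (· * _) (IsScalarTower.algebraMap_apply S K H a))
  let Φ : K ⊗[S] LinearHypersurface S a F →ₐ[K] H :=
    Algebra.TensorProduct.lift (Algebra.ofId K H) φ (fun _ _ => Commute.all _ _)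
  let ι : LinearHypersurface S a F →ₐ[S] K ⊗[S] LinearHypersurface S a F :=
    Algebra.TensorProduct.includeRight
  have hΦ : ∀ b, Φ (ι b) = φ b := fun b => by
    refine (Algebra.TensorProduct.lift_tmul ..).trans ?_
    rw [map_one, one_mul]
  let Ψ : H →ₐ[K] K ⊗[S] LinearHypersurface S a F :=
    lift (ι (y a F)) (fun i => ι (zt a F i)) (by
      have h := congrArg ι (relation a F)
      rw [map_mul, AlgHom.commutes, ← AlgHom.comp_apply, MvPolynomial.comp_aeval] at h
      rw [← IsScalarTower.algebraMap_apply, MvPolynomial.aeval_map_algebraMap]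
      exact h)
  refine ⟨AlgEquiv.ofAlgHom Φ Ψ ?_ ?_⟩
  · apply algHom_ext
    · rw [AlgHom.comp_apply, lift_y, hΦ, lift_y, AlgHom.id_apply]
    · intro i
      rw [AlgHom.comp_apply, lift_zt, hΦ, lift_zt, AlgHom.id_apply]
  · apply Algebra.TensorProduct.ext
    · ext
    · apply algHom_ext
      · change Ψ (Φ (ι (y a F))) = ι (y a F)
        rw [hΦ, lift_y, lift_y]
      · intro i
        change Ψ (Φ (ι (zt a F i))) = ι (zt a F i)
        rw [hΦ, lift_zt, lift_zt]

/-- The equation can be solved for `Y = a⁻¹ F`, leaving `Z` and `T` free. -/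
theorem isPolynomialRing_of_isUnit (ha : IsUnit a) :
    IsPolynomialRing 2 S (LinearHypersurface S a F) := by
  obtain ⟨u, rfl⟩ := ha
  let Φ : LinearHypersurface S u F →ₐ[S] MvPolynomial (Fin 2) S :=
    lift (MvPolynomial.C ((u⁻¹ : Sˣ) : S) * F) MvPolynomial.X (by
      rw [MvPolynomial.algebraMap_eq, ← mul_assoc, ← map_mul, Units.mul_inv, map_one, one_mul,
        MvPolynomial.aeval_X_left, AlgHom.id_apply])
  refine ⟨AlgEquiv.ofAlgHom Φ (MvPolynomial.aeval (zt _ F)) ?_ ?_⟩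
  · apply MvPolynomial.algHom_ext
    intro i
    simp [Φ]
  · apply algHom_ext
    · rw [AlgHom.comp_apply, lift_y, map_mul, ← relation, ← MvPolynomial.algebraMap_eq,
        AlgHom.commutes, ← mul_assoc, ← map_mul, Units.inv_mul, map_one, one_mul, AlgHom.id_apply]
    · intro i
      rw [AlgHom.comp_apply, lift_zt, MvPolynomial.aeval_X, AlgHom.id_apply]

/-- `S[Z, T][Y] / (F)` is a polynomial ring over `S[Z, T] / (F)`. -/
theorem nonempty_zeroEquiv :
    Nonempty (LinearHypersurface S 0 F ≃ₐ[S]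
      Polynomial (MvPolynomial (Fin 2) S ⧸ Ideal.span {F})) := by
  let R := MvPolynomial (Fin 2) S ⧸ Ideal.span {F}
  let q : MvPolynomial (Fin 2) S →ₐ[S] R := Ideal.Quotient.mkₐ S (Ideal.span {F})
  let c : R →ₐ[S] Polynomial R := Polynomial.CAlgHom
  let Φ : LinearHypersurface S 0 F →ₐ[S] Polynomial R :=
    lift Polynomial.X (fun i => c (q (MvPolynomial.X i))) (by
      have h0 : q F = 0 := Ideal.Quotient.eq_zero_iff_mem.mpr (Ideal.mem_span_singleton_self _)
      have h1 : MvPolynomial.aeval (fun i => c (q (MvPolynomial.X i))) = c.comp q := by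
        apply MvPolynomial.algHom_ext
        intro i
        rw [MvPolynomial.aeval_X, AlgHom.comp_apply]
      rw [map_zero, zero_mul, h1, AlgHom.comp_apply, h0, map_zero])
  let δ : R →ₐ[S] LinearHypersurface S 0 F :=
    Ideal.Quotient.liftₐ _ (MvPolynomial.aeval (zt 0 F)) (by
      intro p hp
      obtain ⟨d, rfl⟩ := Ideal.mem_span_singleton.mp hp
      rw [map_mul, ← relation, map_zero, zero_mul, zero_mul])
  have hδ : ∀ i, δ (q (MvPolynomial.X i)) = zt 0 F i := fun i => MvPolynomial.aeval_X _ _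
  let Ψ : Polynomial R →ₐ[S] LinearHypersurface S 0 F :=
    Polynomial.eval₂AlgHom δ (y 0 F) (fun _ => Commute.all _ _)
  have hΨX : Ψ Polynomial.X = y 0 F := Polynomial.eval₂_X _ _
  have hΨc : ∀ b, Ψ (c b) = δ b := fun b => Polynomial.eval₂_C _ _
  refine ⟨AlgEquiv.ofAlgHom Φ Ψ ?_ ?_⟩
  · apply Polynomial.algHom_ext'
    · apply Ideal.Quotient.algHom_ext
      apply MvPolynomial.algHom_ext
      intro i
      change Φ (Ψ (c (q (MvPolynomial.X i)))) = c (q (MvPolynomial.X i))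
      rw [hΨc, hδ, lift_zt]
    · rw [AlgHom.comp_apply, hΨX, lift_y, AlgHom.id_apply]
  · apply algHom_ext
    · rw [AlgHom.comp_apply, lift_y, hΨX, AlgHom.id_apply]
    · intro i
      rw [AlgHom.comp_apply, lift_zt, hΨc, hδ, AlgHom.id_apply]

variable {F} in
theorem isPolynomialRing_zero {k : Type*} [Field k] {f : MvPolynomial (Fin 2) k} (hf : IsLine f) :
    IsPolynomialRing 2 k (LinearHypersurface k 0 f) := by
  obtain ⟨e⟩ := hf
  obtain ⟨e'⟩ := nonempty_zeroEquiv f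
  exact ⟨e'.trans ((Polynomial.mapAlgEquiv e).trans (MvPolynomial.finSuccEquiv k 1).symm)⟩

/-- Base change of the isomorphism over `k`; used with `K` a residue field at which `a` vanishes. -/
theorem isPolynomialRing_zero_map {k : Type*} [Field k] (K : Type*) [CommRing K] [Algebra k K]
    {f : MvPolynomial (Fin 2) k} (hf : IsLine f) :
    IsPolynomialRing 2 K (LinearHypersurface K 0 (MvPolynomial.map (algebraMap k K) f)) := by
  obtain ⟨e⟩ := isPolynomialRing_zero hf
  obtain ⟨e'⟩ := nonempty_baseChange (0 : k) f K
  rw [map_zero] at e'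
  exact ⟨e'.symm.trans ((Algebra.TensorProduct.congr AlgEquiv.refl e).trans
    (MvPolynomial.algebraTensorAlgEquiv k K))⟩

theorem isLine_of_isPolynomialRing {k : Type*} [Field k] {f : MvPolynomial (Fin 2) k}
    (h : IsPolynomialRing 2 k (LinearHypersurface k 0 f)) : IsLine f := by
  obtain ⟨e⟩ := h
  obtain ⟨e'⟩ := nonempty_zeroEquiv f
  exact isPolynomialRing_one_of_polynomial ⟨e'.symm.trans e⟩

/-- `S[Z, T][Y] / (aY - F)` is an affine fibration when `F` restricts to a line where
`a` vanishes. -/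
theorem isAffineFibration {k : Type*} [Field k] [Algebra k S] {a b : S} {n : ℕ} (hab : a ∣ b ^ n)
    {f : MvPolynomial (Fin 2) k} (hf : f ≠ 0) (hline : IsLine f)
    (g : MvPolynomial (Fin 2) S) :
    IsAffineFibration 2 S (LinearHypersurface S a
      (MvPolynomial.map (algebraMap k S) f + MvPolynomial.C b * g)) where
  finiteType := inferInstance
  flat := flat hab hf g
  fibre p _ := by
    obtain ⟨e⟩ := nonempty_baseChange a (MvPolynomial.map (algebraMap k S) f + MvPolynomial.C b * g)
      p.ResidueField
    by_cases ha : algebraMap S p.ResidueField a = 0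
    -- A power of `b` is divisible by `a = 0` in a field, so only `f` survives from `F`.
    · have hb : algebraMap S p.ResidueField b = 0 := by
        have := (map_dvd (algebraMap S p.ResidueField) hab)
        rw [ha, map_pow, zero_dvd_iff] at this
        exact eq_zero_of_pow_eq_zero this
      rw [ha, map_add, map_mul, MvPolynomial.map_C, hb, map_zero, zero_mul, add_zero,
        MvPolynomial.map_map, ← IsScalarTower.algebraMap_eq] at e
      obtain ⟨e'⟩ := isPolynomialRing_zero_map p.ResidueField hline
      exact ⟨e.trans e'⟩
    · obtain ⟨e'⟩ := isPolynomialRing_of_isUnit (algebraMap S p.ResidueField a)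
        (MvPolynomial.map (algebraMap S p.ResidueField)
          (MvPolynomial.map (algebraMap k S) f + MvPolynomial.C b * g)) (IsUnit.mk0 _ ha)
      exact ⟨e.trans e'⟩

end LinearHypersurface

theorem IsAffineFibration.of_algEquiv {n : ℕ} {R B B' : Type*} [CommRing R] [CommRing B]
    [CommRing B'] [Algebra R B] [Algebra R B'] (h : IsAffineFibration n R B) (e : B ≃ₐ[R] B') :
    IsAffineFibration n R B' where
  finiteType := h.finiteType.equiv e
  flat := by
    have := h.flat
    exact Module.Flat.of_linearEquiv e.symm.toLinearEquiv
  fibre p _ := by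
    obtain ⟨e'⟩ := h.fibre p
    exact ⟨(Algebra.TensorProduct.congr AlgEquiv.refl e.symm).trans e'⟩

/-! ### Comparison of `A` with the model, and the three implications -/

namespace LinearHyperplane

variable {k : Type*} [Field k] {m : ℕ} {r : Fin m → ℕ} {F : MvPolynomial (Fin m ⊕ Fin 2) k}
  {f : MvPolynomial (Fin 2) k} {g : MvPolynomial (Fin m ⊕ Fin 2) k}

theorem aeval_map {B B' : Type*} [CommRing B] [Algebra k B] [CommRing B'] [Algebra k B']
    (φ : B →ₐ[k] B') (xs : Fin m → B) (zt' : Fin 2 → B) (F : MvPolynomial (Fin m ⊕ Fin 2) k) :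
    MvPolynomial.aeval (Sum.elim (fun i => φ (xs i)) (fun i => φ (zt' i))) F =
      φ (MvPolynomial.aeval (Sum.elim xs zt') F) := by
  rw [← AlgHom.comp_apply, MvPolynomial.comp_aeval]
  congr 2
  funext i
  cases i <;> rfl

section Specialize

variable {S : Type*} [CommRing S] [Algebra k S]

/-- The polynomial in `Z`, `T` over `S` obtained by substituting `xs i` for `X_i`. -/
noncomputable def specialize (xs : Fin m → S) (G : MvPolynomial (Fin m ⊕ Fin 2) k) :
    MvPolynomial (Fin 2) S :=
  MvPolynomial.aeval (Sum.elim (fun i => MvPolynomial.C (xs i)) MvPolynomial.X) G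

theorem specialize_eq (hF : F = inclZT m f + (∏ i, MvPolynomial.X (Sum.inl i)) * g)
    (xs : Fin m → S) : specialize xs F =
      MvPolynomial.map (algebraMap k S) f + MvPolynomial.C (∏ i, xs i) * specialize xs g := by
  rw [specialize, aeval_eq hF, map_prod, specialize]
  have h : MvPolynomial.aeval MvPolynomial.X = MvPolynomial.mapAlgHom (σ := Fin 2)
      (Algebra.ofId k S) := by
    apply MvPolynomial.algHom_ext
    simp
  rw [h]
  rfl

theorem aeval_specialize {B : Type*} [CommRing B] [Algebra k B] [Algebra S B] [IsScalarTower k S B]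
    (xs : Fin m → S) (z : Fin 2 → B) (G : MvPolynomial (Fin m ⊕ Fin 2) k) :
    MvPolynomial.aeval z (specialize xs G) =
      MvPolynomial.aeval (Sum.elim (fun i => algebraMap S B (xs i)) z) G := by
  have := aeval_map ((MvPolynomial.aeval (R := S) z).restrictScalars k)
    (fun i => MvPolynomial.C (xs i)) MvPolynomial.X G
  exact this.symm.trans (by simp)

end Specialize

section

variable {B : Type*} [CommRing B] [Algebra k B] [Algebra (E r F) B] [IsScalarTower k (E r F) B]

theorem exists_algHomE (y' : B) (z : Fin 2 → B)
    (h : algebraMap (E r F) B (∏ i, xE r F i ^ r i) * y' =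
      MvPolynomial.aeval z (specialize (xE r F) F)) :
    ∃ φ : A r F →ₐ[E r F] B, φ (y r F) = y' ∧ ∀ i, φ (zt r F i) = z i := by
  have hrel : (∏ i, algebraMap (E r F) B (xE r F i) ^ r i) * y' = MvPolynomial.aeval
      (Sum.elim (fun i => algebraMap (E r F) B (xE r F i)) z) F := by
    rw [← aeval_specialize, ← h, map_prod]
    simp only [map_pow]
  exact ⟨toAlgHomE (lift _ y' z hrel) fun i => lift_x .., lift_y _ _ _ hrel,
    lift_zt _ _ _ hrel⟩

end

/-- The `E`-algebra `A` is of the form `E[Z, T][Y] / (aY - F)`. -/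
theorem nonempty_algEquiv_linearHypersurface :
    Nonempty (LinearHypersurface (E r F) (∏ i, xE r F i ^ r i) (specialize (xE r F) F)
      ≃ₐ[E r F] A r F) := by
  let Φ : LinearHypersurface (E r F) (∏ i, xE r F i ^ r i) (specialize (xE r F) F) →ₐ[E r F]
      A r F :=
    LinearHypersurface.lift (y r F) (zt r F) (by
      rw [aeval_specialize, map_prod]
      simpa using relation r F)
  obtain ⟨Ψ, hΨy, hΨz⟩ := exists_algHomE
    (LinearHypersurface.y (∏ i, xE r F i ^ r i) (specialize (xE r F) F))
    (LinearHypersurface.zt _ _) (LinearHypersurface.relation _ _)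
  refine ⟨AlgEquiv.ofAlgHom Φ Ψ ?_ ?_⟩
  · apply algHomE_ext
    · rw [AlgHom.comp_apply, hΨy, LinearHypersurface.lift_y, AlgHom.id_apply]
    · intro i
      rw [AlgHom.comp_apply, hΨz, LinearHypersurface.lift_zt, AlgHom.id_apply]
  · apply LinearHypersurface.algHom_ext
    · rw [AlgHom.comp_apply, LinearHypersurface.lift_y, hΨy, AlgHom.id_apply]
    · intro i
      rw [AlgHom.comp_apply, LinearHypersurface.lift_zt, hΨz, AlgHom.id_apply]

theorem isAffineFibration_of_isLine
    (hF : F = inclZT m f + (∏ i, MvPolynomial.X (Sum.inl i)) * g) (hf : f ≠ 0) (h : IsLine f) :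
    IsAffineFibration 2 (E r F) (A r F) := by
  obtain ⟨e⟩ := nonempty_algEquiv_linearHypersurface (r := r) (F := F)
  have key := LinearHypersurface.isAffineFibration (prod_dvd_pow (r := r) (xE r F)) hf h
    (specialize (xE r F) g)
  rw [← specialize_eq hF] at key
  exact key.of_algEquiv e

theorem algHom_eq_augmentation {B : Type*} [CommRing B] [Algebra k B] (φ : A r F →ₐ[k] B)
    (hφ : ∀ i, φ (x r F i) = 0) (e : E r F) : φ e = algebraMap k B (augmentation r F e) := by
  have h : φ.comp (E r F).val = (Algebra.ofId k B).comp (augmentation r F) := by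
    apply algHom_ext_E
    intro i
    rw [AlgHom.comp_apply, AlgHom.comp_apply, augmentation_xE, map_zero]
    exact hφ i
  exact DFunLike.congr_fun h e

/-- This makes `A / (x_1, …, x_m)` the fibre over the origin. For the harder inclusion, `E` acts on
that quotient through the augmentation, so elements of its kernel act as zero. -/
theorem span_range_x :
    Ideal.span (Set.range (x r F)) =
      (RingHom.ker (augmentation r F)).map (algebraMap (E r F) (A r F)) := by
  apply le_antisymm
  · rw [Ideal.span_le]
    rintro _ ⟨i, rfl⟩
    rw [← algebraMap_xE]
    exact Ideal.mem_map_of_mem _ (augmentation_xE i)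
  · rw [Ideal.map_le_iff_le_comap]
    intro e he
    have he' : augmentation r F e = 0 := he
    have hq : ∀ i, Ideal.Quotient.mkₐ k (Ideal.span (Set.range (x r F))) (x r F i) = 0 :=
      fun i => Ideal.Quotient.eq_zero_iff_mem.mpr (Ideal.subset_span ⟨i, rfl⟩)
    have h := algHom_eq_augmentation (B := A r F ⧸ Ideal.span (Set.range (x r F)))
      (Ideal.Quotient.mkₐ k (Ideal.span (Set.range (x r F)))) hq e
    rw [he', map_zero] at h
    exact Ideal.mem_comap.mpr (Ideal.Quotient.eq_zero_iff_mem.mp h)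

theorem isPolynomialRing_quotient_of_isAffineFibration
    (h : IsAffineFibration 2 (E r F) (A r F)) :
    IsPolynomialRing 2 k (A r F ⧸ Ideal.span (Set.range (x r F))) := by
  rw [span_range_x]
  exact h.isPolynomialRing_quotient (augmentation r F)

/-- Modulo the `x_i`, the algebra `A` becomes `k[Y, Z, T] / (f)`. -/
theorem nonempty_algEquiv_of_ker_eq (hm : 1 ≤ m) (hr : ∀ i, 1 < r i)
    (hF : F = inclZT m f + (∏ i, MvPolynomial.X (Sum.inl i)) * g)
    {Q : Type*} [CommRing Q] [Algebra k Q] (q : A r F →ₐ[k] Q) (hq : Function.Surjective q)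
    (hker : RingHom.ker q = Ideal.span (Set.range (x r F))) :
    Nonempty (LinearHypersurface k 0 f ≃ₐ[k] Q) := by
  -- An actual index is needed: an empty product would be `1`. With it both `∏ x_i` and `∏ x_i ^
  -- r_i` vanish in `Q`, and the relation becomes `f = 0`.
  let i₀ : Fin m := ⟨0, hm⟩
  have hr₀ : r i₀ ≠ 0 := by have := hr i₀; omega
  have hqx : ∀ i, q (x r F i) = 0 := fun i => by
    rw [← RingHom.mem_ker, hker]
    exact Ideal.subset_span ⟨i, rfl⟩
  have h1 : ∏ i, q (x r F i) = 0 := Finset.prod_eq_zero (Finset.mem_univ i₀) (hqx _)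
  have h2 : ∏ i, q (x r F i) ^ r i = 0 :=
    Finset.prod_eq_zero (Finset.mem_univ i₀) (by rw [hqx, zero_pow hr₀])
  let Φ : LinearHypersurface k 0 f →ₐ[k] Q :=
    LinearHypersurface.lift (q (y r F)) (fun i => q (zt r F i)) (by
      have h := congrArg q (relation r F)
      rw [← aeval_map, aeval_eq hF, h1, zero_mul, add_zero, map_mul, map_prod] at h
      simp only [map_pow] at h
      rw [← h, h2, map_zero])
  let ψ : A r F →ₐ[k] LinearHypersurface k 0 f :=
    lift (fun _ => 0) (LinearHypersurface.y 0 f) (LinearHypersurface.zt 0 f) (by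
      have h3 : ∏ _i : Fin m, (0 : LinearHypersurface k 0 f) = 0 :=
        Finset.prod_eq_zero (Finset.mem_univ i₀) rfl
      have h4 : ∏ i : Fin m, (0 : LinearHypersurface k 0 f) ^ r i = 0 :=
        Finset.prod_eq_zero (Finset.mem_univ i₀) (zero_pow hr₀)
      rw [aeval_eq hF, h3, h4, ← LinearHypersurface.relation, map_zero]
      ring)
  have hΦψ : Φ.comp ψ = q := by
    apply algHom_ext
    · intro i
      rw [AlgHom.comp_apply, lift_x, hqx, map_zero]
    · rw [AlgHom.comp_apply, lift_y, LinearHypersurface.lift_y]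
    · intro i
      rw [AlgHom.comp_apply, lift_zt, LinearHypersurface.lift_zt]
  have hψker : RingHom.ker q ≤ RingHom.ker ψ := by
    rw [hker, Ideal.span_le]
    rintro _ ⟨i, rfl⟩
    exact lift_x ..
  let Ψ : Q →ₐ[k] LinearHypersurface k 0 f := AlgHom.liftOfSurjective q hq ψ hψker
  have hΨ : ∀ a, Ψ (q a) = ψ a := fun a => AlgHom.liftOfSurjective_apply ..
  refine ⟨AlgEquiv.ofAlgHom Φ Ψ ?_ ?_⟩
  · ext b
    obtain ⟨a, rfl⟩ := hq b
    rw [AlgHom.comp_apply, hΨ, ← AlgHom.comp_apply, hΦψ, AlgHom.id_apply]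
  · apply LinearHypersurface.algHom_ext
    · rw [AlgHom.comp_apply, LinearHypersurface.lift_y, hΨ, lift_y, AlgHom.id_apply]
    · intro i
      rw [AlgHom.comp_apply, LinearHypersurface.lift_zt, hΨ, lift_zt, AlgHom.id_apply]

theorem isLine_of_isPolynomialRing_quotient (hm : 1 ≤ m) (hr : ∀ i, 1 < r i)
    (hF : F = inclZT m f + (∏ i, MvPolynomial.X (Sum.inl i)) * g)
    (h : IsPolynomialRing 2 k (A r F ⧸ Ideal.span (Set.range (x r F)))) : IsLine f := by
  let I := Ideal.span (Set.range (x r F))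
  obtain ⟨e⟩ := nonempty_algEquiv_of_ker_eq hm hr hF (Q := A r F ⧸ I) (Ideal.Quotient.mkₐ k I)
    Ideal.Quotient.mk_surjective (Ideal.mk_ker (I := I))
  obtain ⟨e'⟩ := h
  exact LinearHypersurface.isLine_of_isPolynomialRing ⟨e.trans e'⟩

end LinearHyperplane

theorem mainTheorem10 {k : Type*} [Field k] {m : ℕ} (hm : 1 ≤ m)
    (r : Fin m → ℕ) (hr : ∀ i, 1 < r i)
    (F : MvPolynomial (Fin m ⊕ Fin 2) k)
    (f : MvPolynomial (Fin 2) k) (hf : f ≠ 0)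
    (g : MvPolynomial (Fin m ⊕ Fin 2) k)
    (hF : F = LinearHyperplane.inclZT m f + (∏ i, MvPolynomial.X (Sum.inl i)) * g) :
    List.TFAE [
      IsAffineFibration 2 (LinearHyperplane.E r F) (LinearHyperplane.A r F),
      IsPolynomialRing 2 k
        (LinearHyperplane.A r F ⧸ Ideal.span (Set.range (LinearHyperplane.x r F))),
      IsLine f] := by

  tfae_have 3 → 1 := LinearHyperplane.isAffineFibration_of_isLine hF hf
  tfae_have 1 → 2 := LinearHyperplane.isPolynomialRing_quotient_of_isAffineFibration
  tfae_have 2 → 3 := LinearHyperplane.isLine_of_isPolynomialRing_quotient hm hr hF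
  tfae_finish
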